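/- Let $N\ge 1$, $\alpha>1/2$ and $0<\gamma<1$, let $B_1=\{x\in\mathbb{R}^N : |x|<1\}$, and write $x=(x_1,\dots,x_N)$. Let $u\in C^2(B_1\setminus\{x_N=0\})\cap C^{0,\gamma}(\overline{B_1})$ be a real-valued function satisfying $-\operatorname{div}(|x_N|^{2\alpha}\nabla u)\ge 0$ weakly in $B_1$, that is, for every $\varphi\in C_0^\infty(B_1)$ with $\varphi\ge 0$ the function $|x_N|^{2\alpha}\nabla u\cdot\nabla\varphi$ is integrable over $B_1$ and $$\int_{B_1}|x_N|^{2\alpha}\,\nabla u\cdot\nabla\varphi\,dx\ \ge\ 0,$$ where $\nabla u$ is the pointwise gradient, defined on $B_1\setminus\{x_N=0\}$, hence almost everywhere in $B_1$. If $u$ is not constant in $B_1$, then $u(x)>\min_{\partial B_1}u$ for every $x\in B_1$, including the points of $B_1\cap\{x_N=0\}$. -/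

import Mathlib

open scoped ContDiff NNReal

/-- `-div(|x_N|^{2α} ∇u) ≥ 0` weakly in the set `Ω ⊆ ℝᴺ`, where `N = n + 1` and `x_N` is the last
coordinate: for every nonnegative `φ ∈ C₀^∞(Ω)` the function `|x_N|^{2α} ∇u · ∇φ` is integrable
over `Ω` and its integral is nonnegative. Here `∇u` is the pointwise gradient; it is used for
functions that are differentiable off the Lebesgue-null hyperplane `{x_N = 0}`, so that it is
defined almost everywhere in `Ω`. -/
def IsWeakSupersolution {n : ℕ} (α : ℝ) (Ω : Set (EuclideanSpace ℝ (Fin (n + 1))))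
    (u : EuclideanSpace ℝ (Fin (n + 1)) → ℝ) : Prop :=
  ∀ φ : EuclideanSpace ℝ (Fin (n + 1)) → ℝ,
    ContDiff ℝ ∞ φ → HasCompactSupport φ → tsupport φ ⊆ Ω → (∀ x, 0 ≤ φ x) →
      MeasureTheory.IntegrableOn
          (fun x => |x (Fin.last n)| ^ (2 * α) * inner ℝ (gradient u x) (gradient φ x)) Ω ∧
        0 ≤ ∫ x in Ω, |x (Fin.last n)| ^ (2 * α) * inner ℝ (gradient u x) (gradient φ x)

open MeasureTheory Metric Set Filter Topology

/-! Let `w = |x_N|^{2α}`, `k = radialKernel`, and let `m = u x₀` be an interior minimum. Testing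
with radial bumps about `x₀` gives `∫ w(x₀+ty) ∇u(x₀+ty)·y k(y) dy ≤ 0` for small `t > 0`
(`integrable_dilation`). This is the part of the `t`-derivative of `A(t) = ∫ c(t) w(x₀+ty) (u(x₀+ty)
- m) k(y) dy` that falls on `u`, up to the factor `c(t) ≥ 0`. If `c(t) w(x₀+ty)` is nonincreasing in
`t`, the other part is nonpositive too, so `A` is nonincreasing (`mean_le_mean`). If that product is
also bounded, `A(t) → 0` as `t → 0` by continuity of `u`, which forces `u = m` near `x₀`
(`eq_on_ball`). On the hyperplane `c = t^{-2α}` works by homogeneity, off it `c = e^{-Lt}` with `L`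
large. Almost every ray from `x₀` avoids the hyperplane for small `t > 0`, so no regularity across
it is needed. Connectedness concludes. -/

/-! ### Radial kernel and radial test functions -/

theorem expNegInvGlue_contDiff_one : ContDiff ℝ 1 expNegInvGlue :=
  expNegInvGlue.contDiff (n := 1)

theorem deriv_expNegInvGlue_of_nonpos {s : ℝ} (hs : s ≤ 0) : deriv expNegInvGlue s = 0 := by
  refine IsLocalMin.deriv_eq_zero (Eventually.of_forall fun t => ?_)
  rw [expNegInvGlue.zero_of_nonpos hs]
  exact expNegInvGlue.nonneg t

theorem deriv_expNegInvGlue_pos {s : ℝ} (hs : 0 < s) : 0 < deriv expNegInvGlue s := by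
  have h1 : HasDerivAt (fun t : ℝ => Real.exp (-t⁻¹)) (Real.exp (-s⁻¹) * (- -(s ^ 2)⁻¹)) s :=
    ((hasDerivAt_inv hs.ne').fun_neg).exp
  have h2 : expNegInvGlue =ᶠ[𝓝 s] fun t : ℝ => Real.exp (-t⁻¹) := by
    filter_upwards [lt_mem_nhds hs] with t ht
    simp [expNegInvGlue, not_le.2 ht]
  rw [h2.deriv_eq, h1.deriv, neg_neg]
  positivity

/-- The continuous radial kernel `y ↦ χ'(1 - |y|²)` with `χ = expNegInvGlue`, positive exactly on
the unit ball. -/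
noncomputable def radialKernel {E : Type*} [NormedAddCommGroup E] (y : E) : ℝ :=
  deriv expNegInvGlue (1 - ‖y‖ ^ 2)

section RadialKernel

variable {E : Type*} [NormedAddCommGroup E]

theorem continuous_radialKernel : Continuous (radialKernel : E → ℝ) :=
  (expNegInvGlue_contDiff_one.continuous_deriv le_rfl).comp (by fun_prop)

theorem radialKernel_eq_zero {y : E} (hy : 1 ≤ ‖y‖) : radialKernel y = 0 :=
  deriv_expNegInvGlue_of_nonpos (by nlinarith)

theorem radialKernel_pos {y : E} (hy : ‖y‖ < 1) : 0 < radialKernel y :=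
  deriv_expNegInvGlue_pos (by nlinarith [norm_nonneg y])

theorem radialKernel_nonneg (y : E) : 0 ≤ radialKernel y := by
  rcases lt_or_ge ‖y‖ 1 with h | h
  · exact (radialKernel_pos h).le
  · exact (radialKernel_eq_zero h).ge

theorem exists_radialKernel_le [NormedSpace ℝ E] [FiniteDimensional ℝ E] :
    ∃ C : ℝ, 0 ≤ C ∧ ∀ y : E, radialKernel y ≤ C := by
  have := FiniteDimensional.proper ℝ E
  obtain ⟨C, hC⟩ := (isCompact_closedBall (0 : E) 1).exists_bound_of_continuousOn
    continuous_radialKernel.continuousOn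
  refine ⟨max C 0, le_max_right _ _, fun y => ?_⟩
  rcases lt_or_ge ‖y‖ 1 with h | h
  · exact (le_abs_self _).trans ((hC y (by simpa using h.le)).trans (le_max_left _ _))
  · rw [radialKernel_eq_zero h]; exact le_max_right _ _

end RadialKernel

/-- The smooth radial bump supported in the closed ball of radius `t` about `x₀`, whose gradient is
a multiple of the radial field times the dilated `radialKernel`. -/
noncomputable def radialBump {E : Type*} [NormedAddCommGroup E] (x₀ : E) (t : ℝ) (z : E) : ℝ :=
  expNegInvGlue (1 - t⁻¹ ^ 2 * ‖z - x₀‖ ^ 2)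

section RadialBump

variable {E : Type*} [NormedAddCommGroup E]

theorem contDiff_radialBump [InnerProductSpace ℝ E] (x₀ : E) (t : ℝ) : ContDiff ℝ ∞ (radialBump x₀ t) :=
  (expNegInvGlue.contDiff (n := ⊤)).comp
    (contDiff_const.sub (contDiff_const.mul ((contDiff_id.sub contDiff_const).norm_sq ℝ)))

theorem tsupport_radialBump_subset (x₀ : E) {t : ℝ} (ht : 0 < t) :
    tsupport (radialBump x₀ t) ⊆ closedBall x₀ t := by
  refine closure_minimal (fun z hz => ?_) isClosed_closedBall
  by_contra h
  rw [mem_closedBall, dist_eq_norm, not_le] at h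
  refine hz (expNegInvGlue.zero_of_nonpos ?_)
  have : 1 ≤ t⁻¹ * ‖z - x₀‖ := by rw [← div_eq_inv_mul, one_le_div ht]; exact h.le
  nlinarith

theorem gradient_radialBump [InnerProductSpace ℝ E] [CompleteSpace E] (x₀ : E) (t : ℝ) (z : E) :
    gradient (radialBump x₀ t) z
      = (-(2 * t⁻¹ ^ 2) * radialKernel (t⁻¹ • (z - x₀))) • (z - x₀) := by
  have h1 : HasFDerivAt (fun z : E => 1 - t⁻¹ ^ 2 * ‖z - x₀‖ ^ 2)
      (-(t⁻¹ ^ 2 • (2 • (innerSL ℝ (z - x₀))))) z := by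
    have := ((hasFDerivAt_id z).sub_const x₀).norm_sq
    refine ((this.const_mul (t⁻¹ ^ 2)).const_sub 1).congr_fderiv ?_
    ext v; simp
  have h2 := ((expNegInvGlue_contDiff_one.differentiable (by norm_num)
    (1 - t⁻¹ ^ 2 * ‖z - x₀‖ ^ 2)).hasDerivAt).comp_hasFDerivAt z h1
  have h3 : radialKernel (t⁻¹ • (z - x₀)) = deriv expNegInvGlue (1 - t⁻¹ ^ 2 * ‖z - x₀‖ ^ 2) := by
    rw [radialKernel, norm_smul, mul_pow, Real.norm_eq_abs, sq_abs]
  refine HasGradientAt.gradient ?_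
  rw [hasGradientAt_iff_hasFDerivAt, h3]
  refine h2.congr_fderiv ?_
  ext v
  simp
  ring

end RadialBump

/-! ### Radial inequality and integrability under dilation -/

section Radial

variable {n : ℕ} {α : ℝ} {Ω : Set (EuclideanSpace ℝ (Fin (n + 1)))}
  {u : EuclideanSpace ℝ (Fin (n + 1)) → ℝ} {x₀ : EuclideanSpace ℝ (Fin (n + 1))}

/-- Tests with `radialBump x₀ t`: the negative factor in its gradient reverses the sign, and the
kernel vanishes off the ball, so integrals over `Ω` extend to the whole space. -/
theorem IsWeakSupersolution.integrable_radial (h : IsWeakSupersolution α Ω u)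
    {t : ℝ} (ht : 0 < t) (hΩ : closedBall x₀ t ⊆ Ω) :
    Integrable (fun z => |z (Fin.last n)| ^ (2 * α) * fderiv ℝ u z (z - x₀)
        * radialKernel (t⁻¹ • (z - x₀))) ∧
      ∫ z, |z (Fin.last n)| ^ (2 * α) * fderiv ℝ u z (z - x₀)
        * radialKernel (t⁻¹ • (z - x₀)) ≤ 0 := by
  obtain ⟨h1, h2⟩ := h (radialBump x₀ t) (contDiff_radialBump x₀ t)
    (HasCompactSupport.of_support_subset_isCompact (isCompact_closedBall x₀ t)
      (subset_closure.trans (tsupport_radialBump_subset x₀ ht)))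
    ((tsupport_radialBump_subset x₀ ht).trans hΩ) (fun x => expNegInvGlue.nonneg _)
  set D := fun z => |z (Fin.last n)| ^ (2 * α) * fderiv ℝ u z (z - x₀)
        * radialKernel (t⁻¹ • (z - x₀)) with hD
  have hk : -(2 * t⁻¹ ^ 2) < 0 := by simp only [Left.neg_neg_iff]; positivity
  have h3 : (fun x => |x (Fin.last n)| ^ (2 * α) *
      inner ℝ (gradient u x) (gradient (radialBump x₀ t) x)) = fun x => -(2 * t⁻¹ ^ 2) * D x := by
    ext x
    rw [gradient_radialBump, inner_smul_right, inner_gradient_left]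
    simp only [hD]
    ring
  have h0 : ∀ x, x ∉ Ω → D x = 0 := by
    intro x hx
    have hx' : ¬ (dist x x₀ ≤ t) := fun h => hx (hΩ h)
    rw [dist_eq_norm, not_le] at hx'
    simp only [hD]
    rw [radialKernel_eq_zero, mul_zero]
    rw [norm_smul, Real.norm_eq_abs, abs_of_pos (inv_pos.2 ht), ← div_eq_inv_mul, one_le_div ht]
    exact hx'.le
  rw [h3] at h1 h2
  have h1' : IntegrableOn D Ω := by
    have := h1.const_mul (-(2 * t⁻¹ ^ 2))⁻¹
    refine this.congr (Eventually.of_forall fun x => ?_)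
    simp only
    rw [inv_mul_cancel_left₀ hk.ne]
  refine ⟨h1'.integrable_of_forall_notMem_eq_zero h0, ?_⟩
  rw [integral_const_mul, setIntegral_eq_integral_of_forall_compl_eq_zero h0] at h2
  nlinarith

theorem IsWeakSupersolution.integrable_dilation (h : IsWeakSupersolution α Ω u)
    {t : ℝ} (ht : 0 < t) (hΩ : closedBall x₀ t ⊆ Ω) :
    Integrable (fun y => |(x₀ + t • y) (Fin.last n)| ^ (2 * α) * fderiv ℝ u (x₀ + t • y) y
        * radialKernel y) ∧
      ∫ y, |(x₀ + t • y) (Fin.last n)| ^ (2 * α) * fderiv ℝ u (x₀ + t • y) y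
        * radialKernel y ≤ 0 := by
  obtain ⟨h1, h2⟩ := h.integrable_radial ht hΩ
  have hf : ∀ y : EuclideanSpace ℝ (Fin (n + 1)),
      |(x₀ + t • y) (Fin.last n)| ^ (2 * α) * fderiv ℝ u (x₀ + t • y) y * radialKernel y
      = t⁻¹ * (|(x₀ + t • y) (Fin.last n)| ^ (2 * α)
        * fderiv ℝ u (x₀ + t • y) ((x₀ + t • y) - x₀)
        * radialKernel (t⁻¹ • ((x₀ + t • y) - x₀))) := by
    intro y
    rw [add_sub_cancel_left, smul_smul, inv_mul_cancel₀ ht.ne', one_smul, map_smul, smul_eq_mul]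
    field_simp
  simp only [hf]
  constructor
  · exact ((h1.comp_add_left x₀).comp_smul ht.ne').const_mul _
  · rw [integral_const_mul, Measure.integral_comp_smul volume
      (fun y => |(x₀ + y) (Fin.last n)| ^ (2 * α) * fderiv ℝ u (x₀ + y) ((x₀ + y) - x₀)
        * radialKernel (t⁻¹ • ((x₀ + y) - x₀))),
      integral_add_left_eq_self (fun z => |z (Fin.last n)| ^ (2 * α) * fderiv ℝ u z (z - x₀)
        * radialKernel (t⁻¹ • (z - x₀)))]
    refine mul_nonpos_of_nonneg_of_nonpos (by positivity) ?_
    rw [smul_eq_mul]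
    exact mul_nonpos_of_nonneg_of_nonpos (abs_nonneg _) h2

/-- The kernel at the larger scale `s` is continuous and positive on the ball of radius `r < s`, so
it can be divided out. -/
theorem IsWeakSupersolution.integrableOn_radial (h : IsWeakSupersolution α Ω u)
    {r s : ℝ} (hr : 0 < r) (hrs : r < s) (hΩ : closedBall x₀ s ⊆ Ω) :
    IntegrableOn (fun z => |z (Fin.last n)| ^ (2 * α) * fderiv ℝ u z (z - x₀))
      (closedBall x₀ r) := by
  have hs := hr.trans hrs
  have h1 := (h.integrable_radial hs hΩ).1.integrableOn (s := closedBall x₀ r)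
  have hpos : ∀ z ∈ closedBall x₀ r, 0 < radialKernel (s⁻¹ • (z - x₀)) := by
    intro z hz
    apply radialKernel_pos
    rw [norm_smul, Real.norm_eq_abs, abs_of_pos (inv_pos.2 hs), ← div_eq_inv_mul, div_lt_one hs]
    rw [mem_closedBall, dist_eq_norm] at hz
    linarith
  have h2 := h1.mul_continuousOn (g' := fun z => (radialKernel (s⁻¹ • (z - x₀)))⁻¹)
    (ContinuousOn.inv₀ (continuous_radialKernel.comp (by fun_prop)).continuousOn
      fun z hz => (hpos z hz).ne') (isCompact_closedBall _ _)
  refine h2.congr_fun (fun z hz => ?_) isClosed_closedBall.measurableSet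
  simp only
  rw [mul_inv_cancel_right₀ (hpos z hz).ne']

theorem measurable_weight_mul_fderiv :
    Measurable fun p : ℝ × EuclideanSpace ℝ (Fin (n + 1)) =>
      |(x₀ + p.1 • p.2) (Fin.last n)| ^ (2 * α) * fderiv ℝ u (x₀ + p.1 • p.2) p.2
        * radialKernel p.2 := by
  have hc : Continuous fun p : ℝ × EuclideanSpace ℝ (Fin (n + 1)) => x₀ + p.1 • p.2 := by fun_prop
  have h1 : Measurable fun p : ℝ × EuclideanSpace ℝ (Fin (n + 1)) =>
      fderiv ℝ u (x₀ + p.1 • p.2) p.2 := by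
    have h2 : Measurable fun p : ℝ × EuclideanSpace ℝ (Fin (n + 1)) =>
      (fderiv ℝ u (x₀ + p.1 • p.2), p.2) :=
      ((measurable_fderiv ℝ u).comp hc.measurable).prodMk measurable_snd
    exact (isBoundedBilinearMap_apply (𝕜 := ℝ)
      (E := EuclideanSpace ℝ (Fin (n + 1))) (F := ℝ)).continuous.measurable.comp h2
  have h3 : Measurable fun p : ℝ × EuclideanSpace ℝ (Fin (n + 1)) =>
      |(x₀ + p.1 • p.2) (Fin.last n)| ^ (2 * α) := by
    have : Measurable fun p : ℝ × EuclideanSpace ℝ (Fin (n + 1)) =>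
        (x₀ + p.1 • p.2) (Fin.last n) :=
      ((EuclideanSpace.proj (𝕜 := ℝ) (Fin.last n)).continuous.comp hc).measurable
    exact (measurable_norm.comp this).pow_const _
  exact (h3.mul h1).mul (continuous_radialKernel.measurable.comp measurable_snd)

/-- Changing variables back bounds every scale `t ≤ r` by one integral over the ball of radius `r`;
this gives the uniform bound that Fubini needs. -/
theorem IsWeakSupersolution.integral_norm_dilation_le (h : IsWeakSupersolution α Ω u)
    {r s : ℝ} (hr : 0 < r) (hrs : r < s) (hΩ : closedBall x₀ s ⊆ Ω) :
    ∃ C : ℝ, ∀ t, 0 < t → t ≤ r →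
      ∫ y, ‖|(x₀ + t • y) (Fin.last n)| ^ (2 * α) * fderiv ℝ u (x₀ + t • y) y
        * radialKernel y‖ ≤ t⁻¹ * (t ^ (n + 1))⁻¹ * C := by
  obtain ⟨K, hK0, hK⟩ := exists_radialKernel_le (E := EuclideanSpace ℝ (Fin (n + 1)))
  have hint := h.integrableOn_radial hr hrs hΩ
  refine ⟨K * ∫ z in closedBall x₀ r, ‖|z (Fin.last n)| ^ (2 * α) * fderiv ℝ u z (z - x₀)‖,
    fun t ht htr => ?_⟩
  set D := fun z : EuclideanSpace ℝ (Fin (n + 1)) =>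
    ‖|z (Fin.last n)| ^ (2 * α) * fderiv ℝ u z (z - x₀)‖ with hD
  have hD' : Integrable ((closedBall x₀ r).indicator D) :=
    (integrable_indicator_iff isClosed_closedBall.measurableSet).2 hint.norm
  have hle : ∀ y : EuclideanSpace ℝ (Fin (n + 1)),
      ‖|(x₀ + t • y) (Fin.last n)| ^ (2 * α) * fderiv ℝ u (x₀ + t • y) y * radialKernel y‖
      ≤ t⁻¹ * K * (closedBall x₀ r).indicator D (x₀ + t • y) := by
    intro y
    rcases le_or_gt 1 ‖y‖ with hy | hy
    · rw [radialKernel_eq_zero hy, mul_zero, norm_zero]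
      have : 0 ≤ (closedBall x₀ r).indicator D (x₀ + t • y) :=
        indicator_nonneg (fun z _ => norm_nonneg _) _
      positivity
    · rw [indicator_of_mem]
      · simp only [hD]
        rw [add_sub_cancel_left, map_smul, smul_eq_mul, norm_mul, norm_mul, norm_mul, norm_mul,
          Real.norm_of_nonneg ht.le, Real.norm_of_nonneg (radialKernel_nonneg y)]
        have := hK y
        calc _ ≤ ‖|(x₀ + t • y) (Fin.last n)| ^ (2 * α)‖ * ‖fderiv ℝ u (x₀ + t • y) y‖ * K := by
              gcongr
          _ = _ := by field_simp
      · rw [mem_closedBall, dist_eq_norm, add_sub_cancel_left, norm_smul, Real.norm_of_nonneg ht.le]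
        nlinarith [norm_nonneg y]
  calc _ ≤ ∫ y, t⁻¹ * K * (closedBall x₀ r).indicator D (x₀ + t • y) :=
        integral_mono_of_nonneg (Eventually.of_forall fun y => norm_nonneg _)
          (((hD'.comp_add_left x₀).comp_smul ht.ne').const_mul _) (Eventually.of_forall hle)
    _ = t⁻¹ * K * ((t ^ (n + 1))⁻¹ * ∫ z in closedBall x₀ r, D z) := by
        rw [integral_const_mul, Measure.integral_comp_smul volume
          (fun y => (closedBall x₀ r).indicator D (x₀ + y)),
          integral_add_left_eq_self ((closedBall x₀ r).indicator D),
          integral_indicator isClosed_closedBall.measurableSet, finrank_euclideanSpace_fin,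
          abs_of_pos (by positivity), smul_eq_mul]
    _ = _ := by ring

theorem IsWeakSupersolution.integrable_prod_dilation (h : IsWeakSupersolution α Ω u)
    {a b s : ℝ} (ha : 0 < a) (hab : a < b) (hbs : b < s) (hΩ : closedBall x₀ s ⊆ Ω)
    {c : ℝ → ℝ} (hc : Measurable c) {M : ℝ} (hM : ∀ t ∈ Ioc a b, ‖c t‖ ≤ M) :
    Integrable (fun p : ℝ × EuclideanSpace ℝ (Fin (n + 1)) =>
      c p.1 * (|(x₀ + p.1 • p.2) (Fin.last n)| ^ (2 * α) * fderiv ℝ u (x₀ + p.1 • p.2) p.2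
        * radialKernel p.2)) ((volume.restrict (Ioc a b)).prod volume) := by
  have hmeas : Measurable (fun p : ℝ × EuclideanSpace ℝ (Fin (n + 1)) =>
      c p.1 * (|(x₀ + p.1 • p.2) (Fin.last n)| ^ (2 * α) * fderiv ℝ u (x₀ + p.1 • p.2) p.2
        * radialKernel p.2)) := (hc.comp measurable_fst).mul measurable_weight_mul_fderiv
  obtain ⟨C, hC⟩ := h.integral_norm_dilation_le (ha.trans hab) hbs hΩ
  rw [integrable_prod_iff hmeas.aestronglyMeasurable]
  constructor
  · filter_upwards [ae_restrict_mem measurableSet_Ioc] with t ht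
    exact ((h.integrable_dilation (ha.trans ht.1)
      ((closedBall_subset_closedBall (ht.2.trans hbs.le)).trans hΩ)).1).const_mul _
  · refine Integrable.mono' (g := fun t => M * (a⁻¹ * (a ^ (n + 1))⁻¹ * |C|))
      (integrable_const _) (hmeas.aestronglyMeasurable.norm.integral_prod_right') ?_
    filter_upwards [ae_restrict_mem measurableSet_Ioc] with t ht
    have ht0 := ha.trans ht.1
    rw [Real.norm_of_nonneg (integral_nonneg fun y => norm_nonneg _)]
    simp only [norm_mul (c t)]
    rw [integral_const_mul]
    have h1 := hC t ht0 ht.2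
    have h2 := hM t ht
    have h3 : t⁻¹ * (t ^ (n + 1))⁻¹ * C ≤ a⁻¹ * (a ^ (n + 1))⁻¹ * |C| := by
      have := ht.1.le
      calc _ ≤ t⁻¹ * (t ^ (n + 1))⁻¹ * |C| := by gcongr; exact le_abs_self C
        _ ≤ _ := by gcongr
    exact mul_le_mul h2 (h1.trans h3) (integral_nonneg fun y => norm_nonneg _)
      ((norm_nonneg _).trans h2)

end Radial

/-! ### Monotonicity of weighted means -/

section Mean

variable {n : ℕ} {α : ℝ} {Ω : Set (EuclideanSpace ℝ (Fin (n + 1)))}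
  {u : EuclideanSpace ℝ (Fin (n + 1)) → ℝ} {x₀ : EuclideanSpace ℝ (Fin (n + 1))}

theorem mem_closedBall_dilation {t : ℝ} (ht : 0 ≤ t) {y : EuclideanSpace ℝ (Fin (n + 1))}
    (hy : ‖y‖ ≤ 1) : x₀ + t • y ∈ closedBall x₀ t := by
  rw [mem_closedBall, dist_eq_norm, add_sub_cancel_left, norm_smul, Real.norm_of_nonneg ht]
  nlinarith [norm_nonneg y]

theorem integrable_mean (hα : 0 < α) (hcont : ContinuousOn u Ω) (c m : ℝ) {t : ℝ} (ht : 0 ≤ t)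
    (hΩ : closedBall x₀ t ⊆ Ω) :
    Integrable fun y => c * |(x₀ + t • y) (Fin.last n)| ^ (2 * α) * (u (x₀ + t • y) - m)
      * radialKernel y := by
  have hc : Continuous fun y : EuclideanSpace ℝ (Fin (n + 1)) => x₀ + t • y := by fun_prop
  have h1 : ContinuousOn (fun y => c * |(x₀ + t • y) (Fin.last n)| ^ (2 * α)
      * (u (x₀ + t • y) - m) * radialKernel y) (closedBall 0 1) := by
    have h2 : Continuous fun y : EuclideanSpace ℝ (Fin (n + 1)) =>
        |(x₀ + t • y) (Fin.last n)| ^ (2 * α) :=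
      (((EuclideanSpace.proj (𝕜 := ℝ) (Fin.last n)).continuous.comp hc).abs).rpow_const
        fun _ => Or.inr (by positivity)
    have h3 : ContinuousOn (fun y => u (x₀ + t • y)) (closedBall 0 1) :=
      hcont.comp hc.continuousOn fun y hy =>
        hΩ (mem_closedBall_dilation ht (by simpa using hy))
    exact ((continuous_const.mul h2).continuousOn.mul (h3.sub continuousOn_const)).mul
      continuous_radialKernel.continuousOn
  refine (h1.integrableOn_compact (isCompact_closedBall 0 1)).integrable_of_forall_notMem_eq_zero
    fun y hy => ?_
  rw [radialKernel_eq_zero, mul_zero]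
  rw [mem_closedBall, dist_zero_right, not_le] at hy
  exact hy.le

/-- The integrand is differentiated along almost every ray, the term with `q'` is dropped by sign,
and Fubini reduces the rest to the radial inequality at each `t`. -/
theorem IsWeakSupersolution.mean_le_mean (h : IsWeakSupersolution α Ω u) (hα : 0 < α)
    (hdiff : ∀ z ∈ Ω, z (Fin.last n) ≠ 0 → DifferentiableAt ℝ u z)
    (hcont : ContinuousOn u Ω) {m : ℝ} (hm : ∀ z ∈ Ω, m ≤ u z)
    {a b s : ℝ} (ha : 0 < a) (hab : a < b) (hbs : b < s) (hΩ : closedBall x₀ s ⊆ Ω)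
    {c : ℝ → ℝ} (hc : Measurable c) {M : ℝ} (hM : ∀ t ∈ Ioc a b, 0 ≤ c t ∧ c t ≤ M)
    (hq : ∀ᵐ y : EuclideanSpace ℝ (Fin (n + 1)), ‖y‖ < 1 → ∀ t ∈ Icc a b,
      (x₀ + t • y) (Fin.last n) ≠ 0 ∧ ∃ q' ≤ 0,
        HasDerivAt (fun τ => c τ * |(x₀ + τ • y) (Fin.last n)| ^ (2 * α)) q' t) :
    ∫ y, c b * |(x₀ + b • y) (Fin.last n)| ^ (2 * α) * (u (x₀ + b • y) - m) * radialKernel y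
    ≤ ∫ y, c a * |(x₀ + a • y) (Fin.last n)| ^ (2 * α) * (u (x₀ + a • y) - m)
        * radialKernel y := by
  have hprod := h.integrable_prod_dilation ha hab hbs hΩ hc (M := M) fun t ht => by
    rw [Real.norm_of_nonneg (hM t ht).1]; exact (hM t ht).2
  set φ : ℝ → EuclideanSpace ℝ (Fin (n + 1)) → ℝ := fun t y =>
    c t * (|(x₀ + t • y) (Fin.last n)| ^ (2 * α) * fderiv ℝ u (x₀ + t • y) y * radialKernel y)
    with hφ
  have hprod' : Integrable (Function.uncurry φ) ((volume.restrict (Ioc a b)).prod volume) := hprod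
  have hmem : ∀ y : EuclideanSpace ℝ (Fin (n + 1)), ‖y‖ < 1 → ∀ t ∈ Icc a b, x₀ + t • y ∈ Ω :=
    fun y hy t ht => hΩ (closedBall_subset_closedBall (ht.2.trans hbs.le)
      (mem_closedBall_dilation (ha.le.trans ht.1) hy.le))
  have hle : ∀ᵐ y : EuclideanSpace ℝ (Fin (n + 1)),
      c b * |(x₀ + b • y) (Fin.last n)| ^ (2 * α) * (u (x₀ + b • y) - m) * radialKernel y
      - c a * |(x₀ + a • y) (Fin.last n)| ^ (2 * α) * (u (x₀ + a • y) - m) * radialKernel y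
      ≤ ∫ t in Ioc a b, φ t y := by
    filter_upwards [hq, hprod'.prod_left_ae] with y hqy hint
    rcases le_or_gt 1 ‖y‖ with hy | hy
    · simp [hφ, radialKernel_eq_zero hy]
    choose! hne q' hq0 hder using hqy hy
    have hline : ∀ t : ℝ, HasDerivAt (fun τ : ℝ => x₀ + τ • y) y t := fun t => by
      simpa using ((hasDerivAt_id t).smul_const y).const_add x₀
    have hderiv : ∀ t ∈ Icc a b, HasDerivAt (fun τ => c τ * |(x₀ + τ • y) (Fin.last n)| ^ (2 * α)
        * (u (x₀ + τ • y) - m) * radialKernel y)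
        ((q' t * (u (x₀ + t • y) - m) + c t * |(x₀ + t • y) (Fin.last n)| ^ (2 * α)
          * fderiv ℝ u (x₀ + t • y) y) * radialKernel y) t := by
      intro t ht
      have h1 := (hdiff _ (hmem y hy t ht) (hne t ht)).hasFDerivAt.comp_hasDerivAt t (hline t)
      exact ((hder t ht).mul (h1.sub_const m)).mul_const _
    rw [← intervalIntegral.integral_of_le hab.le]
    -- Only the upper bound `φ` for the derivative must be integrable in `t`, not the term with
    -- `q'`.
    refine intervalIntegral.sub_le_integral_of_hasDeriv_right_of_le hab.le
      (fun t ht => (hderiv t ht).continuousAt.continuousWithinAt)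
      (fun t ht => (hderiv t (Ioo_subset_Icc_self ht)).hasDerivWithinAt)
      ((integrableOn_Icc_iff_integrableOn_Ioc (by simp)).2 hint) fun t ht => ?_
    have ht' := Ioo_subset_Icc_self ht
    have h1 : q' t * (u (x₀ + t • y) - m) ≤ 0 :=
      mul_nonpos_of_nonpos_of_nonneg (hq0 t ht') (sub_nonneg.2 (hm _ (hmem y hy t ht')))
    have h2 := mul_nonneg (neg_nonneg.2 h1) (radialKernel_nonneg y)
    simp only [hφ]
    linarith
  have hIb := integrable_mean (x₀ := x₀) hα hcont (c b) m (ha.trans hab).le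
    ((closedBall_subset_closedBall hbs.le).trans hΩ)
  have hIa := integrable_mean (x₀ := x₀) hα hcont (c a) m ha.le
    ((closedBall_subset_closedBall (hab.trans hbs).le).trans hΩ)
  have h1 := integral_mono_ae (hIb.sub hIa) hprod'.integral_prod_right hle
  have h2 : (∫ y, ∫ t in Ioc a b, φ t y) ≤ 0 := by
    rw [← integral_integral_swap hprod']
    refine setIntegral_nonpos measurableSet_Ioc fun t ht => ?_
    rw [integral_const_mul]
    exact mul_nonpos_of_nonneg_of_nonpos (hM t ht).1 (h.integrable_dilation (ha.trans ht.1)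
      ((closedBall_subset_closedBall (ht.2.trans hbs.le)).trans hΩ)).2
  rw [integral_sub' hIb hIa] at h1
  exact sub_nonpos.1 (h1.trans h2)

/-- If a weighted supersolution attains its minimum `m` at `x₀`, it equals `m` near `x₀`, provided
the weight is nonincreasing along rays from `x₀` after multiplication by a suitable factor. -/
theorem IsWeakSupersolution.eq_on_ball (h : IsWeakSupersolution α Ω u) (hα : 0 < α)
    (hdiff : ∀ z ∈ Ω, z (Fin.last n) ≠ 0 → DifferentiableAt ℝ u z)
    (hcont : ContinuousOn u Ω) (hmin : ∀ z ∈ Ω, u x₀ ≤ u z)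
    {b s : ℝ} (hb : 0 < b) (hbs : b < s) (hΩ : closedBall x₀ s ⊆ Ω)
    {c : ℝ → ℝ} (hc : Measurable c) (hcb : 0 < c b)
    (hcM : ∀ a, 0 < a → ∃ M, ∀ t ∈ Ioc a b, 0 ≤ c t ∧ c t ≤ M) {K : ℝ}
    (hK : ∀ t ∈ Ioc 0 b, ∀ y : EuclideanSpace ℝ (Fin (n + 1)), ‖y‖ ≤ 1 →
      c t * |(x₀ + t • y) (Fin.last n)| ^ (2 * α) ≤ K)
    (hq : ∀ᵐ y : EuclideanSpace ℝ (Fin (n + 1)), ‖y‖ < 1 → ∀ t ∈ Ioc 0 b,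
      (x₀ + t • y) (Fin.last n) ≠ 0 ∧ ∃ q' ≤ 0,
        HasDerivAt (fun τ => c τ * |(x₀ + τ • y) (Fin.last n)| ^ (2 * α)) q' t) :
    ∀ z ∈ ball x₀ b, u z = u x₀ := by
  set A : ℝ → ℝ := fun t => ∫ y, c t * |(x₀ + t • y) (Fin.last n)| ^ (2 * α)
    * (u (x₀ + t • y) - u x₀) * radialKernel y with hA
  have hx₀ : x₀ ∈ Ω := hΩ (mem_closedBall_self (hb.trans hbs).le)
  have hk0 : Integrable (radialKernel : EuclideanSpace ℝ (Fin (n + 1)) → ℝ) :=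
    (continuous_radialKernel.continuousOn.integrableOn_compact
      (isCompact_closedBall 0 1)).integrable_of_forall_notMem_eq_zero fun y hy =>
        radialKernel_eq_zero (by
          rw [mem_closedBall, dist_zero_right, not_le] at hy
          exact hy.le)
  have hmono : ∀ a ∈ Ioo 0 b, A b ≤ A a := by
    intro a ha
    obtain ⟨M, hM⟩ := hcM a ha.1
    refine h.mean_le_mean hα hdiff hcont hmin ha.1 ha.2 hbs hΩ hc hM ?_
    filter_upwards [hq] with y hy h1 t ht
    exact hy h1 t ⟨ha.1.trans_le ht.1, ht.2⟩
  have hsmall : ∀ ε > 0, A b ≤ ε * (|K| * ∫ y : EuclideanSpace ℝ (Fin (n + 1)),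
      radialKernel y) := by
    intro ε hε
    have h1 : ContinuousAt u x₀ :=
      hcont.continuousAt (mem_of_superset (closedBall_mem_nhds x₀ (hb.trans hbs)) hΩ)
    obtain ⟨δ, hδ, hδ'⟩ := Metric.continuousAt_iff.1 h1 ε hε
    obtain ⟨a, ha0, ha⟩ := exists_between (lt_min hb hδ)
    have hab := ha.trans_le (min_le_left _ _)
    have haδ := ha.trans_le (min_le_right _ _)
    refine (hmono a ⟨ha0, hab⟩).trans ?_
    have hsub : closedBall x₀ a ⊆ Ω := (closedBall_subset_closedBall (hab.trans hbs).le).trans hΩ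
    rw [← mul_assoc, ← integral_const_mul]
    refine integral_mono (integrable_mean hα hcont _ _ ha0.le hsub) (hk0.const_mul _) fun y => ?_
    rcases le_or_gt 1 ‖y‖ with hy | hy
    · simp [radialKernel_eq_zero hy]
    · have hmem := mem_closedBall_dilation (x₀ := x₀) ha0.le hy.le
      have h2 := hδ' ((mem_closedBall.1 hmem).trans_lt haδ)
      rw [Real.dist_eq] at h2
      have h3 := (hK a ⟨ha0, hab.le⟩ y hy.le).trans (le_abs_self K)
      have h4 := (le_abs_self _).trans h2.le
      simp only
      rw [mul_comm ε]
      exact mul_le_mul_of_nonneg_right (mul_le_mul h3 h4 (sub_nonneg.2 (hmin _ (hsub hmem)))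
        (abs_nonneg K)) (radialKernel_nonneg y)
  have hA0 : A b ≤ 0 := by
    set B := |K| * ∫ y : EuclideanSpace ℝ (Fin (n + 1)), radialKernel y
    have hB : 0 ≤ B := mul_nonneg (abs_nonneg K) (integral_nonneg radialKernel_nonneg)
    refine le_of_forall_pos_le_add fun ε hε => ?_
    -- Dividing by `B + 1` avoids having to show `B ≠ 0`.
    refine (hsmall (ε / (B + 1)) (by positivity)).trans ?_
    rw [zero_add, div_mul_eq_mul_div, div_le_iff₀ (by positivity)]
    nlinarith
  have hsub : closedBall x₀ b ⊆ Ω := (closedBall_subset_closedBall hbs.le).trans hΩ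
  have hnn : ∀ y : EuclideanSpace ℝ (Fin (n + 1)),
      0 ≤ c b * |(x₀ + b • y) (Fin.last n)| ^ (2 * α) * (u (x₀ + b • y) - u x₀)
        * radialKernel y := by
    intro y
    rcases le_or_gt 1 ‖y‖ with hy | hy
    · simp [radialKernel_eq_zero hy]
    · have := sub_nonneg.2 (hmin _ (hsub (mem_closedBall_dilation hb.le hy.le)))
      have := radialKernel_nonneg y
      positivity
  have hae := (integral_eq_zero_iff_of_nonneg hnn (integrable_mean hα hcont _ _ hb.le hsub)).1
    (le_antisymm hA0 (integral_nonneg hnn))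
  have hdil : Continuous fun y : EuclideanSpace ℝ (Fin (n + 1)) => x₀ + b • y := by fun_prop
  have heq : EqOn (fun y => u (x₀ + b • y)) (fun _ => u x₀) (ball 0 1) := by
    -- A nonnegative integrand with zero integral vanishes almost everywhere; continuity of `u`
    -- upgrades this to every point.
    refine Measure.eqOn_open_of_ae_eq (μ := volume) ?_ isOpen_ball
      (hcont.comp hdil.continuousOn fun y hy =>
        hsub (mem_closedBall_dilation hb.le (mem_ball_zero_iff.1 hy).le)) continuousOn_const
    filter_upwards [ae_restrict_mem measurableSet_ball, ae_restrict_of_ae hae,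
      ae_restrict_of_ae hq] with y hy h1 h2
    rw [mem_ball_zero_iff] at hy
    have h3 := (h2 hy b ⟨hb, le_rfl⟩).1
    have h4 := radialKernel_pos hy
    have h5 : 0 < |(x₀ + b • y) (Fin.last n)| ^ (2 * α) := Real.rpow_pos_of_pos (abs_pos.2 h3) _
    have h6 := (mul_eq_zero.1 h1).resolve_right h4.ne'
    exact sub_eq_zero.1 ((mul_eq_zero.1 h6).resolve_left (mul_pos hcb h5).ne')
  intro z hz
  have h1 : b⁻¹ • (z - x₀) ∈ ball (0 : EuclideanSpace ℝ (Fin (n + 1))) 1 := by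
    rw [mem_ball_zero_iff, norm_smul, norm_inv, Real.norm_of_nonneg hb.le, ← div_eq_inv_mul,
      div_lt_one hb, ← dist_eq_norm]
    exact hz
  simpa [smul_smul, hb.ne'] using heq h1

end Mean

/-! ### Local constancy at a minimum and the strong minimum principle -/

section StrongMinimum

variable {n : ℕ} {α : ℝ} {Ω : Set (EuclideanSpace ℝ (Fin (n + 1)))}
  {u : EuclideanSpace ℝ (Fin (n + 1)) → ℝ} {x₀ : EuclideanSpace ℝ (Fin (n + 1))}

theorem abs_last_le_norm (y : EuclideanSpace ℝ (Fin (n + 1))) : |y (Fin.last n)| ≤ ‖y‖ :=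
  PiLp.norm_apply_le y (Fin.last n)

theorem ae_last_ne_zero :
    ∀ᵐ y : EuclideanSpace ℝ (Fin (n + 1)), y (Fin.last n) ≠ 0 := by
  set p : EuclideanSpace ℝ (Fin (n + 1)) →L[ℝ] ℝ := EuclideanSpace.proj (Fin.last n) with hp
  have h := Measure.addHaar_submodule (volume : Measure (EuclideanSpace ℝ (Fin (n + 1))))
    (LinearMap.ker p.toLinearMap) fun htop => by
      have h1 : EuclideanSpace.single (Fin.last n) (1 : ℝ) ∈ LinearMap.ker p.toLinearMap :=
        htop ▸ Submodule.mem_top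
      simp [hp] at h1
  rw [ae_iff]
  convert h using 2
  ext y
  simp [hp]

/-- The weight is homogeneous of degree `2α` about a point of the hyperplane, so `c = t^{-2α}` makes
the product independent of `t`. -/
theorem IsWeakSupersolution.eventually_eq_of_last_eq_zero (h : IsWeakSupersolution α Ω u)
    (hα : 0 < α) (hdiff : ∀ z ∈ Ω, z (Fin.last n) ≠ 0 → DifferentiableAt ℝ u z)
    (hcont : ContinuousOn u Ω) (hmin : ∀ z ∈ Ω, u x₀ ≤ u z) (hΩ : Ω ∈ 𝓝 x₀)
    (hx₀ : x₀ (Fin.last n) = 0) : ∀ᶠ z in 𝓝 x₀, u z = u x₀ := by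
  obtain ⟨s, hs, hsΩ⟩ := Metric.nhds_basis_closedBall.mem_iff.1 hΩ
  have hscale : ∀ t > 0, ∀ y : EuclideanSpace ℝ (Fin (n + 1)),
      t ^ (-(2 * α)) * |(x₀ + t • y) (Fin.last n)| ^ (2 * α) = |y (Fin.last n)| ^ (2 * α) := by
    intro t ht y
    rw [PiLp.add_apply, PiLp.smul_apply, hx₀, zero_add, smul_eq_mul, abs_mul, abs_of_pos ht,
      Real.mul_rpow ht.le (abs_nonneg _), ← mul_assoc, ← Real.rpow_add ht, neg_add_cancel,
      Real.rpow_zero, one_mul]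
  refine mem_of_superset (ball_mem_nhds x₀ (half_pos hs)) ?_
  refine h.eq_on_ball hα hdiff hcont hmin (half_pos hs) (half_lt_self hs) hsΩ
    (c := fun t => t ^ (-(2 * α))) (measurable_id.pow_const _)
    (Real.rpow_pos_of_pos (half_pos hs) _)
    (fun a ha => ⟨a ^ (-(2 * α)), fun t ht => ⟨Real.rpow_nonneg (ha.trans ht.1).le _,
      Real.rpow_le_rpow_of_nonpos ha ht.1.le (by linarith)⟩⟩) (K := 1) ?_ ?_
  · intro t ht y hy
    rw [hscale t ht.1]
    exact Real.rpow_le_one (abs_nonneg _) ((abs_last_le_norm y).trans hy) (by positivity)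
  · filter_upwards [ae_last_ne_zero] with y hy _ t ht
    refine ⟨by simpa [hx₀] using ⟨ht.1.ne', hy⟩, 0, le_rfl, ?_⟩
    refine (hasDerivAt_const t (|y (Fin.last n)| ^ (2 * α))).congr_of_eventuallyEq ?_
    filter_upwards [lt_mem_nhds ht.1] with τ hτ
    exact hscale τ hτ y

theorem IsWeakSupersolution.eventually_eq_of_last_ne_zero (h : IsWeakSupersolution α Ω u)
    (hα : 1 / 2 < α) (hdiff : ∀ z ∈ Ω, z (Fin.last n) ≠ 0 → DifferentiableAt ℝ u z)
    (hcont : ContinuousOn u Ω) (hmin : ∀ z ∈ Ω, u x₀ ≤ u z) (hΩ : Ω ∈ 𝓝 x₀)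
    (hx₀ : x₀ (Fin.last n) ≠ 0) : ∀ᶠ z in 𝓝 x₀, u z = u x₀ := by
  have hα0 : 0 < α := by linarith
  obtain ⟨s, hs, hsΩ⟩ := Metric.nhds_basis_closedBall.mem_iff.1 hΩ
  have hpos : 0 < |x₀ (Fin.last n)| := abs_pos.2 hx₀
  -- Below half the distance to the hyperplane, `|x_N|` stays at least `|x₀_N|/2` on the ball.
  obtain ⟨b, hb, hb'⟩ := exists_between (lt_min hs (half_pos hpos))
  have hbs := hb'.trans_le (min_le_left _ _)
  have hbh := hb'.trans_le (min_le_right _ _)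
  -- The logarithmic derivative of the weight along a ray is at most `2α/|x_N| ≤ 4α/|x₀_N|`.
  set L := 4 * α / |x₀ (Fin.last n)| with hL
  have hL0 : 0 < L := by positivity
  have hty : ∀ t ∈ Ioc 0 b, ∀ y : EuclideanSpace ℝ (Fin (n + 1)), ‖y‖ ≤ 1 →
      |t * y (Fin.last n)| ≤ b := by
    intro t ht y hy
    rw [abs_mul, abs_of_pos ht.1]
    have := (abs_last_le_norm y).trans hy
    nlinarith [ht.1, ht.2, abs_nonneg (y (Fin.last n))]
  refine mem_of_superset (ball_mem_nhds x₀ hb) ?_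
  refine h.eq_on_ball hα0 hdiff hcont hmin hb hbs hsΩ
    (c := fun t => Real.exp (-L * t)) (by fun_prop) (Real.exp_pos _)
    (fun a ha => ⟨1, fun t ht => ⟨(Real.exp_pos _).le, Real.exp_le_one_iff.2 ?_⟩⟩)
    (K := (|x₀ (Fin.last n)| + b) ^ (2 * α)) ?_ (Eventually.of_forall ?_)
  · nlinarith [ha.trans ht.1]
  · intro t ht y hy
    have h1 : Real.exp (-L * t) ≤ 1 := Real.exp_le_one_iff.2 (by nlinarith [ht.1])
    have h2 : |(x₀ + t • y) (Fin.last n)| ≤ |x₀ (Fin.last n)| + b := by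
      rw [PiLp.add_apply, PiLp.smul_apply, smul_eq_mul]
      exact (abs_add_le _ _).trans (by linarith [hty t ht y hy])
    calc _ ≤ 1 * (|x₀ (Fin.last n)| + b) ^ (2 * α) := by gcongr
      _ = _ := one_mul _
  · intro y hy t ht
    have hlow : |x₀ (Fin.last n)| / 2 ≤ |x₀ (Fin.last n) + t * y (Fin.last n)| := by
      have := abs_sub_abs_le_abs_sub (x₀ (Fin.last n)) (-(t * y (Fin.last n)))
      rw [abs_neg, sub_neg_eq_add] at this
      linarith [hty t ht y hy.le]
    simp only [PiLp.add_apply, PiLp.smul_apply, smul_eq_mul]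
    set σ := x₀ (Fin.last n) + t * y (Fin.last n) with hσ
    have hσ0 : 0 < |σ| := (half_pos hpos).trans_le hlow
    have hexp : HasDerivAt (fun τ => Real.exp (-L * τ)) (Real.exp (-L * t) * -L) t := by
      simpa using ((hasDerivAt_id t).const_mul (-L)).exp
    have hline : HasDerivAt (fun τ => x₀ (Fin.last n) + τ * y (Fin.last n)) (y (Fin.last n)) t := by
      simpa using ((hasDerivAt_id t).mul_const (y (Fin.last n))).const_add (x₀ (Fin.last n))
    have hpow : HasDerivAt (fun τ => |x₀ (Fin.last n) + τ * y (Fin.last n)| ^ (2 * α))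
        (2 * α * |σ| ^ (2 * α - 2) * σ * y (Fin.last n)) t :=
      HasDerivAt.comp (h₂ := fun s : ℝ => |s| ^ (2 * α)) t
        (hasDerivAt_abs_rpow σ (by linarith : 1 < 2 * α)) hline
    refine ⟨abs_pos.1 hσ0, _, ?_, hexp.mul hpow⟩
    have hsplit : |σ| ^ (2 * α) = |σ| ^ (2 * α - 2) * |σ| ^ 2 := by
      rw [← Real.rpow_natCast |σ| 2, ← Real.rpow_add hσ0]
      norm_num
    have hLσ : 2 * α ≤ L * |σ| := by
      calc 2 * α = L * (|x₀ (Fin.last n)| / 2) := by rw [hL]; field_simp; norm_num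
        _ ≤ _ := by gcongr
    have hσy : σ * y (Fin.last n) ≤ |σ| := by
      refine (le_abs_self _).trans ?_
      rw [abs_mul]
      have := (abs_last_le_norm y).trans hy.le
      nlinarith
    have hw : 0 < |σ| ^ (2 * α - 2) := Real.rpow_pos_of_pos hσ0 _
    have key : 2 * α * (σ * y (Fin.last n)) ≤ L * |σ| ^ 2 := by nlinarith
    have he := Real.exp_pos (-L * t)
    rw [← hσ, hsplit]
    have : Real.exp (-L * t) * -L * (|σ| ^ (2 * α - 2) * |σ| ^ 2)
        + Real.exp (-L * t) * (2 * α * |σ| ^ (2 * α - 2) * σ * y (Fin.last n))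
        = Real.exp (-L * t) * |σ| ^ (2 * α - 2)
          * (2 * α * (σ * y (Fin.last n)) - L * |σ| ^ 2) := by ring
    rw [this]
    exact mul_nonpos_of_nonneg_of_nonpos (by positivity) (by linarith)

/-- Strong minimum principle: a supersolution attaining its minimum over a preconnected open set
is constant there. -/
theorem IsWeakSupersolution.eqOn_of_isMinOn (h : IsWeakSupersolution α Ω u)
    (hα : 1 / 2 < α) (hdiff : ∀ z ∈ Ω, z (Fin.last n) ≠ 0 → DifferentiableAt ℝ u z)
    (hcont : ContinuousOn u Ω) (hΩ : IsOpen Ω) (hconn : IsPreconnected Ω) (hx₀ : x₀ ∈ Ω)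
    (hmin : ∀ z ∈ Ω, u x₀ ≤ u z) : ∀ z ∈ Ω, u z = u x₀ := by
  have hev : ∀ x ∈ Ω, u x = u x₀ → ∀ᶠ z in 𝓝 x, u z = u x₀ := by
    intro x hx hxm
    -- Any point with the minimal value is itself a minimum point, so the local result applies
    -- there.
    rw [← hxm] at hmin ⊢
    by_cases h0 : x (Fin.last n) = 0
    · exact h.eventually_eq_of_last_eq_zero (by linarith) hdiff hcont hmin (hΩ.mem_nhds hx) h0
    · exact h.eventually_eq_of_last_ne_zero hα hdiff hcont hmin (hΩ.mem_nhds hx) h0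
  have hsub : Ω ⊆ interior {z | u z = u x₀} := by
    -- The interior of the level set is relatively closed in `Ω`: continuity carries the value to
    -- limit points, and local constancy makes these interior.
    refine hconn.subset_of_closure_inter_subset isOpen_interior
      ⟨x₀, hx₀, mem_interior_iff_mem_nhds.2 (hev x₀ hx₀ rfl)⟩ ?_
    rintro x ⟨hxc, hx⟩
    refine mem_interior_iff_mem_nhds.2 (hev x hx ?_)
    have hfreq : ∃ᶠ z in 𝓝 x, u z = u x₀ :=
      mem_closure_iff_frequently.1 (closure_mono interior_subset hxc)
    have hcl := isClosed_singleton.mem_of_frequently_of_tendsto (s := {u x₀}) hfreq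
      (hcont.continuousAt (hΩ.mem_nhds hx))
    exact hcl
  exact hsub.trans interior_subset

end StrongMinimum

theorem mainTheorem10 (n : ℕ) (α : ℝ) (hα : 1 / 2 < α)
    (γ : ℝ≥0) (hγ0 : 0 < γ) (hγ1 : γ < 1)
    (u : EuclideanSpace ℝ (Fin (n + 1)) → ℝ)
    (hu2 : ContDiffOn ℝ 2 u (Metric.ball 0 1 \ {x | x (Fin.last n) = 0}))
    (huγ : ∃ C : ℝ≥0, HolderOnWith C γ u (Metric.closedBall 0 1))
    (husuper : IsWeakSupersolution α (Metric.ball 0 1) u)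
    (hunc : ¬ ∃ c : ℝ, ∀ x ∈ Metric.ball (0 : EuclideanSpace ℝ (Fin (n + 1))) 1, u x = c) :
    ∃ m : ℝ, IsLeast (u '' Metric.sphere 0 1) m ∧
      ∀ x ∈ Metric.ball (0 : EuclideanSpace ℝ (Fin (n + 1))) 1, m < u x := by
  obtain ⟨C, hC⟩ := huγ
  have hcont := hC.continuousOn hγ0
  have hplane : IsClosed {x : EuclideanSpace ℝ (Fin (n + 1)) | x (Fin.last n) = 0} :=
    isClosed_eq (EuclideanSpace.proj (𝕜 := ℝ) (Fin.last n)).continuous continuous_const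
  have hdiff : ∀ z ∈ ball (0 : EuclideanSpace ℝ (Fin (n + 1))) 1, z (Fin.last n) ≠ 0 →
      DifferentiableAt ℝ u z := fun z hz hz0 =>
    (hu2.contDiffAt ((isOpen_ball.sdiff hplane).mem_nhds ⟨hz, hz0⟩)).differentiableAt (by norm_num)
  obtain ⟨x₀, hx₀, hmin⟩ := (isCompact_closedBall (0 : EuclideanSpace ℝ (Fin (n + 1)))
    1).exists_isMinOn ⟨0, mem_closedBall_self zero_le_one⟩ hcont
  have hlt : ∀ x ∈ ball (0 : EuclideanSpace ℝ (Fin (n + 1))) 1, u x₀ < u x := by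
    intro x hx
    refine lt_of_le_of_ne (hmin (ball_subset_closedBall hx)) fun heq => hunc ⟨u x, ?_⟩
    exact husuper.eqOn_of_isMinOn hα hdiff (hcont.mono ball_subset_closedBall) isOpen_ball
      (convex_ball _ _).isPreconnected hx fun z hz => heq ▸ hmin (ball_subset_closedBall hz)
  refine ⟨u x₀, ⟨⟨x₀, ?_, rfl⟩, ?_⟩, hlt⟩
  -- A minimiser inside the ball would satisfy `u x₀ < u x₀`.
  · by_contra hns
    exact (hlt x₀ (mem_ball.2 (lt_of_le_of_ne (mem_closedBall.1 hx₀) hns))).false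
  · rintro _ ⟨z, hz, rfl⟩
    exact hmin (sphere_subset_closedBall hz)
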